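/- Proposition. Let $C\in\mathbb{R}$ (the Courant number). Consider the fourth-order D1Q3 lattice Boltzmann scheme: discrete velocities $c_1=0$, $c_2=1$, $c_3=-1$, moment matrix $$M=\begin{pmatrix}1&1&1\\0&1&-1\\0&1&1\end{pmatrix},$$ equilibrium vector $\epsilon=(1,\,C,\,\tfrac13(1+2C^2))^{\mathsf T}$, relaxation parameters $s_1\in\mathbb{R}$ arbitrary and $s_2=s_3=2$. Put $K=I+\mathrm{diag}(s_1,s_2,s_3)(\epsilon e_1^{\mathsf T}-I)$ and $E=M\,\mathrm{diag}(T^{-c_1},T^{-c_2},T^{-c_3})\,M^{-1}K$, where $T$ is the shift $(Tu)_j=u_{j+1}$; let $\hat E(\kappa)$ be the matrix obtained from $E$ by replacing $T$ with $\kappa\in\mathbb{C}\setminus\{0\}$. The scheme on the infinite domain is $m^{n+1}_j=E\,m^n_j$ for $j\in\mathbb{Z}$, $n\in\mathbb{N}$, with $m^n_j\in\mathbb{R}^3$. 1. Assume $|C|\neq 1$. The scheme is von Neumann stable, i.e. the spectrum of $\hat E(e^{i\vartheta})$ is contained in the closed unit disk for every $\vartheta\in[-\pi,\pi]$, if and only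 if $|C|\le\tfrac12$. 2. The scheme is $L^2$-stable, i.e. there is a constant $A>0$ such that for all $\Delta x>0$, all initial data $(m^0_j)_{j\in\mathbb{Z}}$ in $(\ell^2_{\Delta x})^3$ and all $n\in\mathbb{N}$, $$\sum_{j\in\mathbb{Z}}\Delta x\,|m^n_j|^2\le A\sum_{j\in\mathbb{Z}}\Delta x\,|m^0_j|^2,$$ if and only if $|C|<\tfrac12$. 3. Write $\det(zI-E)=z^3+\gamma_2z^2+\gamma_1z+\gamma_0$, where the $\gamma_\ell$ are Laurent polynomials in $T$. The corresponding finite-difference scheme $u^{n+1}_j=-(\gamma_2u^n_j+\gamma_1u^{n-1}_j+\gamma_0u^{n-2}_j)$, $n\ge2$, $j\in\mathbb{Z}$, is $L^2$-stable for no value of $C$: there is no constant $A>0$ such that for all $\Delta x>0$, all initial data $u^0,u^1,u^2\in\ell^2_{\Delta x}$ and all $n\in\mathbb{N}$, $$\sum_{j\in\mathbb{Z}}\Delta x\,|u^n_j|^2\le A\sum_{\ell=0}^{2}\sum_{j\in\mathbb{Z}}\Delta x\,|u^\ell_j|^2.$$ -/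

import Mathlib

open scoped LaurentPolynomial

noncomputable section

/-- The data of a linear one-dimensional multiple-relaxation-times lattice Boltzmann scheme with
`q` discrete velocities. Indices start at `0`, and the moment of index `0` is the conserved one. -/
structure LBScheme (q : ℕ) [NeZero q] where
  /-- the discrete velocities -/
  velocity : Fin q → ℤ
  /-- the moment matrix -/
  momentMatrix : Matrix (Fin q) (Fin q) ℝ
  momentMatrix_isUnit : IsUnit momentMatrix.det
  /-- the relaxation parameters -/
  relax : Fin q → ℝ
  relax_mem : ∀ i, i ≠ 0 → relax i ∈ Set.Ioc (0 : ℝ) 2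
  /-- the equilibrium coefficients -/
  equil : Fin q → ℝ
  equil_zero : equil 0 = 1

/-- The action on a sequence `u : ℤ → ℝ` of a Laurent polynomial in the forward space shift `T`,
`(T u)_j = u_{j+1}`: the sequence `j ↦ ∑ k, p_k u_{j+k}`. -/
def shiftAction (p : ℝ[T;T⁻¹]) (u : ℤ → ℝ) (j : ℤ) : ℝ :=
  p.coeff.sum fun k a => a * u (j + k)

/-- `u` belongs to `ℓ²_{Δx}(ℤ)`. -/
def IsSquareSummable (Δx : ℝ) (u : ℤ → ℝ) : Prop :=
  Summable fun j => Δx * u j ^ 2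

namespace LBScheme

variable {q : ℕ} [NeZero q] (S : LBScheme q)

/-- The relaxation matrix on the moments, `K = I + diag(s) (ε e₁ᵀ - I)`. -/
def relaxMatrix : Matrix (Fin q) (Fin q) ℝ :=
  1 + Matrix.diagonal S.relax * (Matrix.vecMulVec S.equil (Pi.single 0 1) - 1)

/-- The bulk scheme matrix `E = M diag(T^{-c_i}) M⁻¹ K`, with Laurent polynomial entries. -/
def bulkMatrix : Matrix (Fin q) (Fin q) ℝ[T;T⁻¹] :=
  S.momentMatrix.map LaurentPolynomial.C
    * Matrix.diagonal (fun i => LaurentPolynomial.T (-S.velocity i))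
    * S.momentMatrix⁻¹.map LaurentPolynomial.C
    * S.relaxMatrix.map LaurentPolynomial.C

/-- The matrix `Ê(κ)`, obtained from `E` by substituting `κ` for the shift. -/
def symbol (κ : ℂˣ) : Matrix (Fin q) (Fin q) ℂ :=
  S.bulkMatrix.map (LaurentPolynomial.eval₂ (algebraMap ℝ ℂ) κ)

/-- von Neumann stability: for all `θ ∈ [-π, π]`, the spectrum of `Ê(e^{iθ})` lies in the closed
unit disk. -/
def VonNeumannStable : Prop :=
  ∀ θ ∈ Set.Icc (-Real.pi) Real.pi,
    spectrum ℂ (S.symbol (Circle.toUnits (Circle.exp θ))) ⊆ Metric.closedBall 0 1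

/-- `m n j i` is the `i`-th moment at time step `n` and grid point `j` of a solution of the scheme
on the infinite domain: `m^{n+1}_j = E m^n_j` for `j ∈ ℤ`. -/
def IsSolution (m : ℕ → ℤ → Fin q → ℝ) : Prop :=
  ∀ n j i, m (n + 1) j i = ∑ k, shiftAction (S.bulkMatrix i k) (fun l => m n l k) j

/-- `L²` stability of the lattice Boltzmann scheme, with the Euclidean norm on `ℝ^q`. -/
def L2Stable : Prop :=
  ∃ K : ℝ, 0 < K ∧ ∀ Δx : ℝ, 0 < Δx → ∀ m : ℕ → ℤ → Fin q → ℝ,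
    (∀ i, IsSquareSummable Δx fun j => m 0 j i) → S.IsSolution m →
    ∀ n, (∀ i, IsSquareSummable Δx fun j => m n j i) ∧
      ∑' j, Δx * ∑ i, m n j i ^ 2 ≤ K * ∑' j, Δx * ∑ i, m 0 j i ^ 2

/-- The number `s` of non-conserved moments that do not relax on their equilibrium. -/
def numNonEquil : ℕ :=
  Nat.card {i : Fin q // i ≠ 0 ∧ S.relax i ≠ 1}

/-- The coefficient `γ_ℓ` of `z^ℓ` in `det (z I - E)`. -/
def charCoeff (l : ℕ) : ℝ[T;T⁻¹] :=
  S.bulkMatrix.charpoly.coeff l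

/-- `u` solves the corresponding Finite Difference scheme
`u^{n+1}_j = - ∑_{ℓ=0}^{s} γ_{q-ℓ-1} u^{n-ℓ}_j` for `n ≥ s` and `j ∈ ℤ`. Here `s ≤ q - 1`, so no
subtraction is truncated. -/
def IsFDSolution (u : ℕ → ℤ → ℝ) : Prop :=
  ∀ n, S.numNonEquil ≤ n → ∀ j,
    u (n + 1) j = -∑ l ∈ Finset.range (S.numNonEquil + 1),
      shiftAction (S.charCoeff (q - l - 1)) (u (n - l)) j

/-- `L²` stability of the corresponding Finite Difference scheme, with respect to its initial
data `u^0, …, u^s`. -/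
def FDStable : Prop :=
  ∃ K : ℝ, 0 < K ∧ ∀ Δx : ℝ, 0 < Δx → ∀ u : ℕ → ℤ → ℝ,
    (∀ l ≤ S.numNonEquil, IsSquareSummable Δx (u l)) → S.IsFDSolution u →
    ∀ n, IsSquareSummable Δx (u n) ∧
      ∑' j, Δx * u n j ^ 2
        ≤ K * ∑ l ∈ Finset.range (S.numNonEquil + 1), ∑' j, Δx * u l j ^ 2

end LBScheme

/-- The fourth-order D1Q3 scheme with Courant number `C`; the relaxation parameter `s₁` of the
conserved moment is arbitrary. -/
def fourthOrderD1Q3 (s₁ C : ℝ) : LBScheme 3 where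
  velocity := ![0, 1, -1]
  momentMatrix := !![1, 1, 1; 0, 1, -1; 0, 1, 1]
  momentMatrix_isUnit := by
    simp [Matrix.det_fin_three, isUnit_iff_ne_zero]
  relax := ![s₁, 2, 2]
  relax_mem := by
    intro i hi
    fin_cases i <;> simp at hi ⊢
  equil := ![1, C, (1 + 2 * C ^ 2) / 3]
  equil_zero := by simp

end

/-! With `s₂ = s₃ = 2` the collision acts on the populations as f ↦ 2 m₀ w − f, where m₀ = ∑ fᵢ and
the equilibrium weights w, namely 2(1 − C²)/3 and (1 ± C)(1 ± 2C)/6, sum to 1 and are positive for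
|C| < 1/2. This is an orthogonal reflection for ∑ fᵢ²/wᵢ, and transport only shifts, so the total
`populationEnergy` is conserved: hence L² stability.

Conversely, testing with truncated plane waves on long windows bounds the powers of the symbol
uniformly on the unit circle (`ShiftBounded.sum_norm_sq_pow_mulVec_le`). This excludes eigenvalues
outside the disk and Jordan blocks on the circle. The characteristic polynomial there is z³ − τz² +
τ̄z − 1. Its roots have product 1, so if none leaves the disk all are unimodular, which forces a
nonpositive discriminant (`discr_nonpos_of_roots_mem_disk`). An explicit frequency makes it positive
when |C| > 1/2 and |C| ≠ 1; at |C| = 1/2 and |C| = 1 explicit Jordan blocks exclude L² stability.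

For the Finite Difference scheme, at κ = 1 the polynomial is (z − 1)(z + 1)² for every C. The symbol
is diagonalizable there, but the companion matrix has a Jordan block at −1. -/

noncomputable section

/-! ### Laurent polynomials in the shift acting on sequences -/

theorem shiftAction_add (p p' : ℝ[T;T⁻¹]) (u : ℤ → ℝ) (j : ℤ) :
    shiftAction (p + p') u j = shiftAction p u j + shiftAction p' u j := by
  unfold shiftAction
  exact Finsupp.sum_add_index' (by simp) (by intros; ring)

theorem shiftAction_C_mul_T (a : ℝ) (k : ℤ) (u : ℤ → ℝ) (j : ℤ) :
    shiftAction (LaurentPolynomial.C a * LaurentPolynomial.T k) u j = a * u (j + k) := by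
  unfold shiftAction
  rw [← LaurentPolynomial.single_eq_C_mul_T]
  exact Finsupp.sum_single_index (by simp)

theorem shiftAction_C (a : ℝ) (u : ℤ → ℝ) (j : ℤ) :
    shiftAction (LaurentPolynomial.C a) u j = a * u j := by
  simpa using shiftAction_C_mul_T a 0 u j

/-- Every Laurent polynomial has a finite stencil. -/
theorem exists_shiftAction_congr (p : ℝ[T;T⁻¹]) :
    ∃ d : ℕ, ∀ (u v : ℤ → ℝ) (j : ℤ), (∀ l, |l - j| ≤ d → u l = v l) →
      shiftAction p u j = shiftAction p v j := by
  induction p using LaurentPolynomial.induction_on' with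
  | add p q hp hq =>
    obtain ⟨d, hd⟩ := hp
    obtain ⟨e, he⟩ := hq
    refine ⟨d + e, fun u v j h => ?_⟩
    rw [shiftAction_add, shiftAction_add, hd u v j fun l hl => h l (by push_cast; omega),
      he u v j fun l hl => h l (by push_cast; omega)]
  | C_mul_T n a =>
    refine ⟨n.natAbs, fun u v j h => ?_⟩
    rw [shiftAction_C_mul_T, shiftAction_C_mul_T, h (j + n) (by simp)]

theorem shiftAction_of_symbol (p : ℝ[T;T⁻¹]) (κ : ℂˣ) (z : ℂ) (j : ℤ) :
    shiftAction p (fun l => ((κ ^ l : ℂˣ) * z).re) j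
        = ((κ ^ j : ℂˣ) * (LaurentPolynomial.eval₂ (algebraMap ℝ ℂ) κ p * z)).re := by
  induction p using LaurentPolynomial.induction_on' with
  | add p q hp hq => rw [shiftAction_add, hp, hq, map_add, add_mul, mul_add, Complex.add_re]
  | C_mul_T n a =>
    rw [shiftAction_C_mul_T, LaurentPolynomial.eval₂_C_mul_T, ← Complex.re_ofReal_mul, zpow_add,
      Units.val_mul]
    congr 1
    simp only [Complex.coe_algebraMap]
    ring

/-! ### Plane waves and necessary conditions for `ℓ²` stability -/

/-- `m` solves the one-step recurrence with matrix `A` on the infinite domain. -/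
def IsShiftSolution {ι : Type*} [Fintype ι] (A : Matrix ι ι ℝ[T;T⁻¹]) (m : ℕ → ℤ → ι → ℝ) : Prop :=
  ∀ n j i, m (n + 1) j i = ∑ k, shiftAction (A i k) (fun l => m n l k) j

/-- The `ℓ²` norm of the solutions with finitely supported data is bounded in terms of the data. -/
def ShiftBounded {ι : Type*} [Fintype ι] (A : Matrix ι ι ℝ[T;T⁻¹]) (K : ℝ) : Prop :=
  ∀ m : ℕ → ℤ → ι → ℝ, (∃ L : ℕ, ∀ j, (L : ℤ) < |j| → m 0 j = 0) → IsShiftSolution A m →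
    ∀ n, (Summable fun j => ∑ i, m n j i ^ 2) ∧
      ∑' j, ∑ i, m n j i ^ 2 ≤ K * ∑' j, ∑ i, m 0 j i ^ 2

section
variable {ι : Type*} [Fintype ι]

/-- The solution of the recurrence with matrix `A` and initial data `m₀`. -/
def shiftSolution (A : Matrix ι ι ℝ[T;T⁻¹]) (m₀ : ℤ → ι → ℝ) : ℕ → ℤ → ι → ℝ
  | 0 => m₀
  | n + 1 => fun j i => ∑ k, shiftAction (A i k) (fun l => shiftSolution A m₀ n l k) j

theorem isShiftSolution_shiftSolution (A : Matrix ι ι ℝ[T;T⁻¹]) (m₀ : ℤ → ι → ℝ) :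
    IsShiftSolution A (shiftSolution A m₀) := fun _ _ _ => rfl

/-- Finite speed of propagation. -/
theorem exists_speed (A : Matrix ι ι ℝ[T;T⁻¹]) :
    ∃ d : ℕ, ∀ m w : ℕ → ℤ → ι → ℝ, IsShiftSolution A m → IsShiftSolution A w →
      ∀ L : ℕ, (∀ j, |j| ≤ (L : ℤ) → m 0 j = w 0 j) →
        ∀ (n : ℕ) (j : ℤ), |j| + d * n ≤ (L : ℤ) → m n j = w n j := by
  choose d hd using fun i k => exists_shiftAction_congr (A i k)
  refine ⟨∑ i, ∑ k, d i k, fun m w hm hw L h0 n => ?_⟩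
  have hle : ∀ i k, d i k ≤ ∑ i, ∑ k, d i k := fun i k =>
    (Finset.single_le_sum (f := d i) (fun _ _ => Nat.zero_le _) (Finset.mem_univ k)).trans
      (Finset.single_le_sum (f := fun i => ∑ k, d i k) (fun _ _ => Nat.zero_le _)
        (Finset.mem_univ i))
  generalize ∑ i, ∑ k, d i k = D at hle
  induction n with
  | zero => intro j hj; exact h0 j (by simpa using hj)
  | succ n ih =>
    intro j hj
    funext i
    rw [hm, hw]
    refine Finset.sum_congr rfl fun k _ => hd i k _ _ j fun l hl => ?_
    rw [ih l]
    have h1 : (d i k : ℤ) ≤ D := by exact_mod_cast hle i k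
    have h2 : |l| ≤ |l - j| + |j| := by simpa using abs_add_le (l - j) j
    push_cast at hj
    linarith

/-- Cutting the data outside the domain of dependence of a window leaves the solution in it
unchanged. The bound thus reaches solutions that are not square summable, such as plane waves. -/
theorem sum_sq_window_le {A : Matrix ι ι ℝ[T;T⁻¹]} {K : ℝ} (hA : ShiftBounded A K) :
    ∃ d : ℕ, ∀ w : ℕ → ℤ → ι → ℝ, IsShiftSolution A w → ∀ n L : ℕ,
      ∑ j ∈ Finset.Icc (-L : ℤ) L, ∑ i, w n j i ^ 2
        ≤ K * ∑ j ∈ Finset.Icc (-(L + d * n : ℕ) : ℤ) (L + d * n : ℕ), ∑ i, w 0 j i ^ 2 := by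
  obtain ⟨d, hd⟩ := exists_speed A
  refine ⟨d, fun w hw n L => ?_⟩
  set R := L + d * n with hR
  set m := shiftSolution A fun j => if |j| ≤ (R : ℤ) then w 0 j else 0 with hm
  have h0 : ∀ j, m 0 j = if |j| ≤ (R : ℤ) then w 0 j else 0 := fun j => rfl
  have hs := isShiftSolution_shiftSolution A fun j => if |j| ≤ (R : ℤ) then w 0 j else 0
  rw [← hm] at hs
  obtain ⟨h1, h2⟩ := hA m ⟨R, fun j hj => by rw [h0, if_neg (not_le.mpr hj)]⟩ hs n
  have h3 : ∑' j, ∑ i, m 0 j i ^ 2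
      = ∑ j ∈ Finset.Icc (-R : ℤ) R, ∑ i, w 0 j i ^ 2 := by
    rw [tsum_eq_sum (s := Finset.Icc (-R : ℤ) R)]
    · refine Finset.sum_congr rfl fun j hj => ?_
      rw [h0, if_pos (abs_le.mpr (Finset.mem_Icc.mp hj))]
    · intro j hj
      rw [h0, if_neg fun h => hj (Finset.mem_Icc.mpr (abs_le.mp h))]
      simp
  rw [h3] at h2
  refine le_trans ?_ h2
  refine le_trans (le_of_eq ?_)
    (h1.sum_le_tsum (Finset.Icc (-L : ℤ) L) fun j _ => Finset.sum_nonneg fun i _ => sq_nonneg _)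
  refine Finset.sum_congr rfl fun j hj => ?_
  rw [hd m w hs hw R (fun j hj => by rw [h0, if_pos hj]) n j]
  have := abs_le.mpr (Finset.mem_Icc.mp hj)
  rw [hR]; push_cast; linarith

theorem isShiftSolution_planeWave [DecidableEq ι] (A : Matrix ι ι ℝ[T;T⁻¹]) (κ : ℂˣ)
    (v : ι → ℂ) :
    IsShiftSolution A fun n j i => ((κ ^ j : ℂˣ) *
      ((A.map (LaurentPolynomial.eval₂ (algebraMap ℝ ℂ) κ) ^ n).mulVec v i)).re := by
  intro n j i
  simp only [shiftAction_of_symbol]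
  rw [← Complex.re_sum, ← Finset.mul_sum, pow_succ', ← Matrix.mulVec_mulVec]
  rfl

/-- The boundary layer `c` becomes negligible against the window length 2L + 1. -/
theorem le_of_forall_mul_le {a b : ℝ} (c : ℝ)
    (h : ∀ L : ℕ, a * (2 * L + 1) ≤ b * (2 * L + 1 + c)) : a ≤ b := by
  by_contra! hab
  obtain ⟨L, hL⟩ := exists_nat_gt (b * c / (a - b))
  rw [div_lt_iff₀ (by linarith)] at hL
  nlinarith [h L, Nat.cast_nonneg (α := ℝ) L]

/-- The powers of the symbol of an `ℓ²` stable recurrence are uniformly bounded on the unit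
circle. -/
theorem ShiftBounded.sum_norm_sq_pow_mulVec_le [DecidableEq ι] {A : Matrix ι ι ℝ[T;T⁻¹]} {K : ℝ}
    (hA : ShiftBounded A K) {κ : ℂˣ} (hκ : ‖(κ : ℂ)‖ = 1) (v : ι → ℂ) (n : ℕ) :
    ∑ i, ‖(A.map (LaurentPolynomial.eval₂ (algebraMap ℝ ℂ) κ) ^ n).mulVec v i‖ ^ 2
      ≤ K * ∑ i, ‖v i‖ ^ 2 := by
  obtain ⟨d, hd⟩ := sum_sq_window_le hA
  set E := A.map (LaurentPolynomial.eval₂ (algebraMap ℝ ℂ) κ) with hE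
  -- Solutions are real: the real parts of the waves generated by v and −iv together recover the
  -- complex modulus.
  have key : ∀ (z : ℂ) (j : ℤ), ((κ ^ j : ℂˣ) * z).re ^ 2
      + ((κ ^ j : ℂˣ) * (-Complex.I * z)).re ^ 2 = ‖z‖ ^ 2 := by
    intro z j
    have h1 : ‖((κ ^ j : ℂˣ) : ℂ) * z‖ ^ 2 = ‖z‖ ^ 2 := by simp [hκ]
    rw [← h1, ← Complex.normSq_eq_norm_sq, Complex.normSq_apply]
    simp only [Complex.mul_re, Complex.mul_im, Complex.neg_re, Complex.neg_im, Complex.I_re,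
      Complex.I_im]
    ring
  have hcard : ∀ L : ℕ, ((Finset.Icc (-L : ℤ) L).card : ℝ) = 2 * L + 1 := by
    intro L
    rw [Int.card_Icc]
    have : ((L : ℤ) + 1 - -L).toNat = 2 * L + 1 := by omega
    rw [this]; push_cast; ring
  have hsum : ∀ (n L : ℕ), ∑ j ∈ Finset.Icc (-L : ℤ) L,
        ∑ i, ((κ ^ j : ℂˣ) * (E ^ n).mulVec v i).re ^ 2
      + ∑ j ∈ Finset.Icc (-L : ℤ) L,
        ∑ i, ((κ ^ j : ℂˣ) * (E ^ n).mulVec (-Complex.I • v) i).re ^ 2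
      = (∑ i, ‖(E ^ n).mulVec v i‖ ^ 2) * (2 * L + 1) := by
    intro n L
    simp only [Matrix.mulVec_smul, Pi.smul_apply, smul_eq_mul, ← Finset.sum_add_distrib, key,
      Finset.sum_const, nsmul_eq_mul, hcard]
    ring
  refine le_of_forall_mul_le (2 * (d * n)) fun L => ?_
  have h1 := hd _ (isShiftSolution_planeWave A κ v) n L
  have h2 := hd _ (isShiftSolution_planeWave A κ (-Complex.I • v)) n L
  have h3 := add_le_add h1 h2
  rw [← mul_add, hsum, hsum] at h3
  refine h3.trans (le_of_eq ?_)
  simp only [pow_zero, Matrix.one_mulVec]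
  push_cast
  ring

/-- A vector whose orbit under the symbol grows linearly excludes `ℓ²` stability. -/
theorem ShiftBounded.not_of_jordan [DecidableEq ι] {A : Matrix ι ι ℝ[T;T⁻¹]} {K : ℝ}
    (hA : ShiftBounded A K) {κ : ℂˣ} (hκ : ‖(κ : ℂ)‖ = 1) {z : ℂ} (hz : ‖z‖ = 1) {v w : ι → ℂ}
    (hw : w ≠ 0) (hEw : (A.map (LaurentPolynomial.eval₂ (algebraMap ℝ ℂ) κ)).mulVec w = z • w)
    (hEv : (A.map (LaurentPolynomial.eval₂ (algebraMap ℝ ℂ) κ)).mulVec v = z • (v + w)) :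
    False := by
  have h := hA.sum_norm_sq_pow_mulVec_le hκ v
  set E := A.map (LaurentPolynomial.eval₂ (algebraMap ℝ ℂ) κ)
  have hn : ∀ n : ℕ, (E ^ n).mulVec v = z ^ n • (v + (n : ℂ) • w) := by
    intro n
    induction n with
    | zero => simp
    | succ n ih =>
      rw [pow_succ', ← Matrix.mulVec_mulVec, ih, Matrix.mulVec_smul, Matrix.mulVec_add,
        Matrix.mulVec_smul, hEw, hEv]
      ext i
      simp only [Pi.smul_apply, Pi.add_apply, smul_eq_mul]
      push_cast
      ring
  obtain ⟨i, hi⟩ := Function.ne_iff.mp hw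
  have hb : ∀ n : ℕ, ‖v i + n * w i‖ ^ 2 ≤ K * ∑ i, ‖v i‖ ^ 2 := by
    intro n
    refine le_trans ?_ (h n)
    refine le_trans (le_of_eq ?_) (Finset.single_le_sum
      (f := fun i => ‖(E ^ n).mulVec v i‖ ^ 2) (fun _ _ => sq_nonneg _) (Finset.mem_univ i))
    simp [hn, hz]
  set B := K * ∑ i, ‖v i‖ ^ 2
  have hpos : 0 < ‖w i‖ := norm_pos_iff.mpr hi
  -- The square is removed by t ≤ t² + 1 with t = ‖v i + n w i‖.
  have hB : ∀ n : ℕ, n * ‖w i‖ ≤ B + 1 + ‖v i‖ := by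
    intro n
    have h1 : ‖(n : ℂ) * w i‖ ≤ ‖v i + n * w i‖ + ‖v i‖ := by
      simpa using norm_sub_le (v i + n * w i) (v i)
    rw [norm_mul, Complex.norm_natCast] at h1
    nlinarith [hb n, sq_nonneg (‖v i + n * w i‖ - 1), sq_nonneg (‖v i + n * w i‖)]
  obtain ⟨n, hn'⟩ := exists_nat_gt ((B + 1 + ‖v i‖) / ‖w i‖)
  rw [div_lt_iff₀ hpos] at hn'
  linarith [hB n]

/-- `ℓ²` stability implies the von Neumann condition. -/
theorem ShiftBounded.norm_eigenvalue_le_one [DecidableEq ι] {A : Matrix ι ι ℝ[T;T⁻¹]} {K : ℝ}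
    (hA : ShiftBounded A K) {κ : ℂˣ} (hκ : ‖(κ : ℂ)‖ = 1) {z : ℂ}
    (hz : z ∈ spectrum ℂ (A.map (LaurentPolynomial.eval₂ (algebraMap ℝ ℂ) κ))) : ‖z‖ ≤ 1 := by
  set E := A.map (LaurentPolynomial.eval₂ (algebraMap ℝ ℂ) κ) with hE
  rw [← Matrix.spectrum_toLin', ← Module.End.hasEigenvalue_iff_mem_spectrum] at hz
  obtain ⟨v, hv⟩ := hz.exists_hasEigenvector
  have hEv : E.mulVec v = z • v := by simpa using hv.apply_eq_smul
  have hn : ∀ n : ℕ, (E ^ n).mulVec v = z ^ n • v := by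
    intro n
    induction n with
    | zero => simp
    | succ n ih => rw [pow_succ', ← Matrix.mulVec_mulVec, ih, Matrix.mulVec_smul, hEv, smul_smul,
        pow_succ]
  have hpos : 0 < ∑ i, ‖v i‖ ^ 2 := by
    obtain ⟨i, hi⟩ := Function.ne_iff.mp hv.2
    exact Finset.sum_pos' (fun _ _ => sq_nonneg _)
      ⟨i, Finset.mem_univ i, pow_pos (norm_pos_iff.mpr hi) 2⟩
  by_contra! h1
  obtain ⟨n, hn'⟩ := pow_unbounded_of_one_lt K (show 1 < ‖z‖ ^ 2 by nlinarith)
  have h := hA.sum_norm_sq_pow_mulVec_le hκ v n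
  rw [← hE, hn] at h
  simp only [Pi.smul_apply, smul_eq_mul, norm_mul, norm_pow, mul_pow, ← Finset.mul_sum] at h
  have := le_of_mul_le_mul_right h hpos
  rw [← pow_mul, mul_comm, pow_mul] at this
  linarith

end

theorem LBScheme.L2Stable.exists_shiftBounded {q : ℕ} [NeZero q] {S : LBScheme q}
    (h : S.L2Stable) : ∃ K, ShiftBounded S.bulkMatrix K := by
  obtain ⟨K, -, hK⟩ := h
  refine ⟨K, fun m ⟨L, hL⟩ hm n => ?_⟩
  have h0 : ∀ i, IsSquareSummable 1 fun j => m 0 j i := by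
    intro i
    refine summable_of_hasFiniteSupport ((Set.finite_Icc (-L : ℤ) L).subset fun j hj => ?_)
    by_contra hj'
    refine hj ?_
    have : m 0 j = 0 := hL j (lt_of_not_ge fun h => hj' (Set.mem_Icc.mpr (abs_le.mp h)))
    simp [this]
  have := hK 1 one_pos m h0 hm n
  simp only [IsSquareSummable, one_mul] at this
  exact ⟨summable_sum fun i _ => this.1 i, this.2⟩

/-! ### Explicit symbol and characteristic polynomial -/

theorem momentMatrix_inv_fourthOrderD1Q3 (s₁ C : ℝ) :
    (fourthOrderD1Q3 s₁ C).momentMatrix⁻¹ = !![1, 0, -1; 0, 1 / 2, 1 / 2; 0, -1 / 2, 1 / 2] := by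
  refine Matrix.inv_eq_right_inv ?_
  ext i j
  fin_cases i <;> fin_cases j <;>
    simp [fourthOrderD1Q3, Matrix.mul_apply, Fin.sum_univ_three] <;> norm_num

theorem relaxMatrix_fourthOrderD1Q3 (s₁ C : ℝ) :
    (fourthOrderD1Q3 s₁ C).relaxMatrix
      = !![1, 0, 0; 2 * C, -1, 0; 2 * ((1 + 2 * C ^ 2) / 3), 0, -1] := by
  ext i j
  simp only [LBScheme.relaxMatrix, fourthOrderD1Q3, Matrix.add_apply, Matrix.diagonal_mul,
    Matrix.sub_apply, Matrix.vecMulVec_apply, Matrix.one_apply]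
  fin_cases i <;> fin_cases j <;> simp <;> norm_num

/-- The three-point Laurent polynomial `a + b T + c T⁻¹`. -/
def threePoint (a b c : ℝ) : ℝ[T;T⁻¹] :=
  LaurentPolynomial.C a * LaurentPolynomial.T 0 + LaurentPolynomial.C b * LaurentPolynomial.T 1
    + LaurentPolynomial.C c * LaurentPolynomial.T (-1)

theorem shiftAction_threePoint (a b c : ℝ) (u : ℤ → ℝ) (j : ℤ) :
    shiftAction (threePoint a b c) u j = a * u j + b * u (j + 1) + c * u (j - 1) := by
  simp [threePoint, shiftAction_add, shiftAction_C_mul_T, sub_eq_add_neg, -LaurentPolynomial.T_zero]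

theorem eval₂_threePoint (a b c : ℝ) (κ : ℂˣ) :
    LaurentPolynomial.eval₂ (algebraMap ℝ ℂ) κ (threePoint a b c)
      = a + b * κ + c * (κ : ℂ)⁻¹ := by
  simp only [threePoint, map_add, LaurentPolynomial.eval₂_C_mul_T]
  simp

theorem bulkMatrix_fourthOrderD1Q3 (s₁ C e : ℝ) (he : e = (1 + 2 * C ^ 2) / 3) :
    (fourthOrderD1Q3 s₁ C).bulkMatrix =
      !![threePoint (1 - 2 * e) (e - C) (e + C), threePoint 0 (1 / 2) (-1 / 2),
          threePoint 1 (-1 / 2) (-1 / 2);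
        threePoint 0 (C - e) (C + e), threePoint 0 (-1 / 2) (-1 / 2),
          threePoint 0 (1 / 2) (-1 / 2);
        threePoint 0 (e - C) (e + C), threePoint 0 (1 / 2) (-1 / 2),
          threePoint 0 (-1 / 2) (-1 / 2)] := by
  rw [LBScheme.bulkMatrix, momentMatrix_inv_fourthOrderD1Q3, relaxMatrix_fourthOrderD1Q3, ← he]
  have key : ∀ (a : ℝ) (p : ℝ[T;T⁻¹]), LaurentPolynomial.C a * p = a • p := fun a p =>
    (LaurentPolynomial.smul_eq_C_mul a p).symm
  have key' : ∀ (a : ℝ), LaurentPolynomial.C a = a • (1 : ℝ[T;T⁻¹]) := fun a => by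
    rw [← key, mul_one]
  refine Matrix.ext fun i j => ?_
  fin_cases i <;> fin_cases j <;>
    simp [fourthOrderD1Q3, Matrix.mul_apply, Fin.sum_univ_three, Matrix.diagonal, threePoint,
      -LaurentPolynomial.T_zero, -map_mul, -map_add, -map_sub, -map_neg,
      -map_inv₀, -map_div₀] <;>
    simp only [key', LaurentPolynomial.T_zero, smul_mul_assoc, mul_smul_comm, one_mul, mul_one] <;>
    module

/-- The trace of the symbol of the fourth-order D1Q3 scheme. -/
def symbolTrace (C : ℝ) (κ : ℂ) : ℂ :=
  1 - (κ + κ⁻¹) + C * (κ⁻¹ - κ) + (1 + 2 * C ^ 2) / 3 * (κ + κ⁻¹ - 2)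

theorem symbol_fourthOrderD1Q3 (s₁ C : ℝ) (κ : ℂˣ) {e k l : ℂ} (he : e = (1 + 2 * C ^ 2) / 3)
    (hk : k = κ) (hl : l = (κ : ℂ)⁻¹) :
    (fourthOrderD1Q3 s₁ C).symbol κ =
      !![1 - 2 * e + (e - C) * k + (e + C) * l, (k - l) / 2, 1 - (k + l) / 2;
        (C - e) * k + (C + e) * l, -(k + l) / 2, (k - l) / 2;
        (e - C) * k + (e + C) * l, (k - l) / 2, -(k + l) / 2] := by
  rw [LBScheme.symbol, bulkMatrix_fourthOrderD1Q3 s₁ C _ rfl]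
  subst he hk hl
  ext i j
  fin_cases i <;> fin_cases j <;> simp [eval₂_threePoint] <;> ring

theorem det_sub_symbol (s₁ C : ℝ) (κ : ℂˣ) (z : ℂ) :
    (algebraMap ℂ (Matrix (Fin 3) (Fin 3) ℂ) z - (fourthOrderD1Q3 s₁ C).symbol κ).det
      = z ^ 3 - symbolTrace C κ * z ^ 2 + symbolTrace C (κ : ℂ)⁻¹ * z - 1 := by
  rw [symbol_fourthOrderD1Q3 s₁ C κ rfl rfl rfl, symbolTrace, symbolTrace, inv_inv,
    Matrix.det_fin_three]
  have hk : (κ : ℂ) ≠ 0 := κ.ne_zero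
  simp only [Matrix.sub_apply, Matrix.algebraMap_matrix_apply]
  simp
  field_simp
  ring

theorem mem_spectrum_symbol_iff (s₁ C : ℝ) (κ : ℂˣ) (z : ℂ) :
    z ∈ spectrum ℂ ((fourthOrderD1Q3 s₁ C).symbol κ)
      ↔ z ^ 3 - symbolTrace C κ * z ^ 2 + symbolTrace C (κ : ℂ)⁻¹ * z - 1 = 0 := by
  rw [spectrum.mem_iff, Matrix.isUnit_iff_isUnit_det, det_sub_symbol, isUnit_iff_ne_zero, not_not]

/-! ### Discriminant of a self-inversive cubic -/

theorem exists_cubic_roots (a b c : ℂ) :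
    ∃ x y z : ℂ, x + y + z = a ∧ x * y + y * z + z * x = b ∧ x * y * z = c := by
  obtain ⟨x, hx⟩ := IsAlgClosed.exists_root (⟨1, -a, b, -c⟩ : Cubic ℂ).toPoly (by
    rw [Cubic.degree_of_a_ne_zero one_ne_zero]; decide)
  obtain ⟨s, hs⟩ := IsAlgClosed.exists_pow_nat_eq ((a - x) ^ 2 - 4 * (b - x * (a - x))) two_pos
  -- The other two roots solve X² − (a − x)X + (b − x(a − x)) = 0, whose discriminant is s².
  refine ⟨x, (a - x + s) / 2, (a - x - s) / 2, by ring, by linear_combination -hs / 4, ?_⟩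
  simp [Cubic.toPoly] at hx
  linear_combination -x * hs / 4 + hx

/-- If the roots of a self-inversive cubic lie in the closed unit disk, its discriminant is
nonpositive. -/
theorem discr_nonpos_of_roots_mem_disk {a b : ℝ}
    (h : ∀ z : ℂ, z ^ 3 - (⟨a, b⟩ : ℂ) * z ^ 2 + (⟨a, -b⟩ : ℂ) * z - 1 = 0 → ‖z‖ ≤ 1) :
    (a ^ 2 + b ^ 2) ^ 2 - 8 * (a ^ 3 - 3 * a * b ^ 2) + 18 * (a ^ 2 + b ^ 2) - 27 ≤ 0 := by
  obtain ⟨x, y, z, h1, h2, h3⟩ := exists_cubic_roots ⟨a, b⟩ ⟨a, -b⟩ 1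
  have hx : ‖x‖ ≤ 1 := h x (by rw [← h1, ← h2, ← h3]; ring)
  have hy : ‖y‖ ≤ 1 := h y (by rw [← h1, ← h2, ← h3]; ring)
  have hz : ‖z‖ ≤ 1 := h z (by rw [← h1, ← h2, ← h3]; ring)
  have hn : ‖x‖ * ‖y‖ * ‖z‖ = 1 := by rw [← norm_mul, ← norm_mul, h3, norm_one]
  have hxy : ‖x‖ * ‖y‖ ≤ 1 := mul_le_one₀ hx (norm_nonneg _) hy
  have hxz : ‖x‖ * ‖z‖ ≤ 1 := mul_le_one₀ hx (norm_nonneg _) hz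
  have hyz : ‖y‖ * ‖z‖ ≤ 1 := mul_le_one₀ hy (norm_nonneg _) hz
  have hx1 : ‖x‖ = 1 := le_antisymm hx (by nlinarith [norm_nonneg x])
  have hy1 : ‖y‖ = 1 := le_antisymm hy (by nlinarith [norm_nonneg y])
  have hz1 : ‖z‖ = 1 := le_antisymm hz (by nlinarith [norm_nonneg z])
  have conj_mul : ∀ w : ℂ, ‖w‖ = 1 → w * (starRingEnd ℂ) w = 1 := fun w hw => by
    rw [Complex.mul_conj, Complex.normSq_eq_norm_sq, hw]; norm_num
  have ex := conj_mul x hx1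
  have ey := conj_mul y hy1
  have ez := conj_mul z hz1
  -- For unimodular roots with xyz = 1, conjugation is inversion: x̄ = x⁻¹ = yz.
  have e1 : (starRingEnd ℂ) x = y * z := by
    linear_combination (-(starRingEnd ℂ) x) * h3 + y * z * ex
  have e2 : (starRingEnd ℂ) y = z * x := by
    linear_combination (-(starRingEnd ℂ) y) * h3 + x * z * ey
  have e3 : (starRingEnd ℂ) z = x * y := by
    linear_combination (-(starRingEnd ℂ) z) * h3 + x * y * ez
  have key : (((a ^ 2 + b ^ 2) ^ 2 - 8 * (a ^ 3 - 3 * a * b ^ 2) + 18 * (a ^ 2 + b ^ 2) - 27 : ℝ)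
      : ℂ) = ((-(Complex.normSq (x - y) * Complex.normSq (y - z) * Complex.normSq (z - x)) : ℝ)
      : ℂ) := by
    have hd : (((a ^ 2 + b ^ 2) ^ 2 - 8 * (a ^ 3 - 3 * a * b ^ 2) + 18 * (a ^ 2 + b ^ 2) - 27 : ℝ)
        : ℂ) = (⟨a, b⟩ : ℂ) ^ 2 * (⟨a, -b⟩ : ℂ) ^ 2 - 4 * (⟨a, -b⟩ : ℂ) ^ 3 - 4 * (⟨a, b⟩ : ℂ) ^ 3
          - 27 + 18 * (⟨a, b⟩ : ℂ) * (⟨a, -b⟩ : ℂ) := by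
      rw [show (⟨a, b⟩ : ℂ) = a + b * Complex.I from Complex.mk_eq_add_mul_I a b,
        show (⟨a, -b⟩ : ℂ) = a - b * Complex.I by
          rw [Complex.mk_eq_add_mul_I]; push_cast; ring]
      push_cast
      ring_nf
      simp only [Complex.I_sq, show Complex.I ^ 4 = 1 from Complex.I_pow_four]
      ring
    rw [hd, ← h1, ← h2]
    push_cast
    rw [Complex.normSq_eq_conj_mul_self, Complex.normSq_eq_conj_mul_self,
      Complex.normSq_eq_conj_mul_self, map_sub, map_sub, map_sub, e1, e2, e3]
    have h4 : (x * y * z) = 1 := h3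
    generalize hp : x * y * z = p at h4
    have : (x + y + z) ^ 2 * (x * y + y * z + z * x) ^ 2 - 4 * (x * y + y * z + z * x) ^ 3
        - 4 * (x + y + z) ^ 3 * (x * y * z) - 27 * (x * y * z) ^ 2
        + 18 * (x + y + z) * (x * y + y * z + z * x) * (x * y * z)
        = ((x - y) * (y - z) * (z - x)) ^ 2 := by ring
    -- The conjugate of x − y is −z(x − y), and cyclically; so the product of the squared distances
    -- is minus the discriminant.
    have hr : (y * z - z * x) * (x - y) * ((z * x - x * y) * (y - z))
        * ((x * y - y * z) * (z - x)) = -(x * y * z) * ((x - y) * (y - z) * (z - x)) ^ 2 := by ring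
    rw [hp, h4] at this hr
    linear_combination this + hr
  have key' := Complex.ofReal_injective key
  rw [key']
  have := mul_nonneg (mul_nonneg (Complex.normSq_nonneg (x - y)) (Complex.normSq_nonneg (y - z)))
    (Complex.normSq_nonneg (z - x))
  linarith

/-! ### Conserved energy and stability for |C| < 1/2 -/

theorem threePoint_shift_invariance {p q r : ℤ → ℝ} (hp : ∀ j, 0 ≤ p j) (hq : ∀ j, 0 ≤ q j)
    (hr : ∀ j, 0 ≤ r j) (h : Summable fun j => p j + q j + r j) :
    (Summable fun j => p j + q (j - 1) + r (j + 1)) ∧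
      ∑' j, (p j + q (j - 1) + r (j + 1)) = ∑' j, (p j + q j + r j) := by
  have sp : Summable p := h.of_nonneg_of_le hp fun j => by linarith [hq j, hr j]
  have sq : Summable q := h.of_nonneg_of_le hq fun j => by linarith [hp j, hr j]
  have sr : Summable r := h.of_nonneg_of_le hr fun j => by linarith [hp j, hq j]
  have sq' : Summable fun j => q (j - 1) := (Equiv.subRight (1 : ℤ)).summable_iff.mpr sq
  have sr' : Summable fun j => r (j + 1) := (Equiv.addRight (1 : ℤ)).summable_iff.mpr sr
  refine ⟨(sp.add sq').add sr', ?_⟩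
  rw [(sp.add sq').tsum_add sr', sp.tsum_add sq', (sp.add sq).tsum_add sr, sp.tsum_add sq,
    ← (Equiv.subRight (1 : ℤ)).tsum_eq q, ← (Equiv.addRight (1 : ℤ)).tsum_eq r]
  rfl

/-- The quadratic energy `∑ᵢ fᵢ² / εᵢ` of the populations, as a function of the moments. -/
def populationEnergy (C x y z : ℝ) : ℝ :=
  (x - z) ^ 2 / (2 * (1 - C ^ 2) / 3) + ((y + z) / 2) ^ 2 / ((1 + C) * (1 + 2 * C) / 6)
    + ((z - y) / 2) ^ 2 / ((1 - C) * (1 - 2 * C) / 6)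

/-- The weights are at most 1, so the energy dominates ∑ fᵢ². With x = f₀ + f₊ + f₋, y = f₊ − f₋ and
z = f₊ + f₋, x² costs a factor 3 and y² + z² a factor 2. -/
theorem sq_add_sq_add_sq_le_populationEnergy {C : ℝ} (hC : |C| < 1 / 2) (x y z : ℝ) :
    x ^ 2 + y ^ 2 + z ^ 2 ≤ 5 * populationEnergy C x y z := by
  obtain ⟨h1, h2⟩ := abs_lt.mp hC
  have hle : ∀ a b : ℝ, 0 < b → b ≤ 1 → a ^ 2 ≤ a ^ 2 / b := fun a b hb hb1 => by
    rw [le_div_iff₀ hb]; nlinarith [sq_nonneg a]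
  have e0 := hle (x - z) (2 * (1 - C ^ 2) / 3) (by nlinarith) (by nlinarith)
  have e1 := hle ((y + z) / 2) ((1 + C) * (1 + 2 * C) / 6) (by nlinarith) (by nlinarith)
  have e2 := hle ((z - y) / 2) ((1 - C) * (1 - 2 * C) / 6) (by nlinarith) (by nlinarith)
  unfold populationEnergy
  nlinarith [sq_nonneg ((x - z) - (y + z) / 2), sq_nonneg ((x - z) - (z - y) / 2),
    sq_nonneg ((y + z) / 2 - (z - y) / 2)]

theorem exists_populationEnergy_le {C : ℝ} (hC : |C| < 1 / 2) :
    ∃ A : ℝ, 0 < A ∧ ∀ x y z : ℝ, populationEnergy C x y z ≤ A * (x ^ 2 + y ^ 2 + z ^ 2) := by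
  obtain ⟨h1, h2⟩ := abs_lt.mp hC
  have p0 : 0 < 2 * (1 - C ^ 2) / 3 := by nlinarith
  have p1 : 0 < (1 + C) * (1 + 2 * C) / 6 := by nlinarith
  have p2 : 0 < (1 - C) * (1 - 2 * C) / 6 := by nlinarith
  refine ⟨2 * ((2 * (1 - C ^ 2) / 3)⁻¹ + ((1 + C) * (1 + 2 * C) / 6)⁻¹
    + ((1 - C) * (1 - 2 * C) / 6)⁻¹), by positivity, fun x y z => ?_⟩
  have b0 : (x - z) ^ 2 ≤ 2 * (x ^ 2 + y ^ 2 + z ^ 2) := by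
    nlinarith [sq_nonneg (x + z), sq_nonneg y]
  have b1 : ((y + z) / 2) ^ 2 ≤ 2 * (x ^ 2 + y ^ 2 + z ^ 2) := by
    nlinarith [sq_nonneg (y - z), sq_nonneg x]
  have b2 : ((z - y) / 2) ^ 2 ≤ 2 * (x ^ 2 + y ^ 2 + z ^ 2) := by
    nlinarith [sq_nonneg (y + z), sq_nonneg x]
  have := add_le_add (add_le_add (mul_le_mul_of_nonneg_right b0 (inv_pos.mpr p0).le)
    (mul_le_mul_of_nonneg_right b1 (inv_pos.mpr p1).le))
    (mul_le_mul_of_nonneg_right b2 (inv_pos.mpr p2).le)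
  simp only [populationEnergy, div_eq_mul_inv] at this ⊢
  linarith

/-- The energy of the populations is conserved by the fourth-order scheme. -/
theorem populationEnergy_conserved {s₁ C : ℝ} (hC : |C| < 1 / 2) {m : ℕ → ℤ → Fin 3 → ℝ}
    (hm : (fourthOrderD1Q3 s₁ C).IsSolution m) (n : ℕ)
    (h : Summable fun j => populationEnergy C (m n j 0) (m n j 1) (m n j 2)) :
    (Summable fun j => populationEnergy C (m (n + 1) j 0) (m (n + 1) j 1) (m (n + 1) j 2)) ∧
      ∑' j, populationEnergy C (m (n + 1) j 0) (m (n + 1) j 1) (m (n + 1) j 2)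
        = ∑' j, populationEnergy C (m n j 0) (m n j 1) (m n j 2) := by
  obtain ⟨h1, h2⟩ := abs_lt.mp hC
  have p0 : 0 < 2 * (1 - C ^ 2) / 3 := by nlinarith
  have p1 : 0 < (1 + C) * (1 + 2 * C) / 6 := by nlinarith
  have p2 : 0 < (1 - C) * (1 - 2 * C) / 6 := by nlinarith
  have hm' := fun j i => hm n j i
  simp only [bulkMatrix_fourthOrderD1Q3 s₁ C _ rfl, Fin.sum_univ_three] at hm'
  have m0 := fun j => hm' j 0
  have m1 := fun j => hm' j 1
  have m2 := fun j => hm' j 2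
  simp [shiftAction_threePoint] at m0 m1 m2
  -- After the reflection the rest population stays at j, while the moving ones arrive from j − 1
  -- and j + 1.
  have hnew : ∀ j, populationEnergy C (m (n + 1) j 0) (m (n + 1) j 1) (m (n + 1) j 2)
      = (m n j 2 - m n j 0 + 2 * (2 * (1 - C ^ 2) / 3) * m n j 0) ^ 2 / (2 * (1 - C ^ 2) / 3)
        + (-(m n (j - 1) 1 + m n (j - 1) 2) / 2
          + 2 * ((1 + C) * (1 + 2 * C) / 6) * m n (j - 1) 0) ^ 2 / ((1 + C) * (1 + 2 * C) / 6)
        + ((m n (j + 1) 1 - m n (j + 1) 2) / 2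
          + 2 * ((1 - C) * (1 - 2 * C) / 6) * m n (j + 1) 0) ^ 2
            / ((1 - C) * (1 - 2 * C) / 6) := by
    intro j
    rw [populationEnergy, m0, m1, m2]
    congr 1
    · congr 1
      · congr 2; ring
      · congr 2; ring
    · congr 2; ring
  have hold : ∀ j, populationEnergy C (m n j 0) (m n j 1) (m n j 2)
      = (m n j 2 - m n j 0 + 2 * (2 * (1 - C ^ 2) / 3) * m n j 0) ^ 2 / (2 * (1 - C ^ 2) / 3)
        + (-(m n j 1 + m n j 2) / 2
          + 2 * ((1 + C) * (1 + 2 * C) / 6) * m n j 0) ^ 2 / ((1 + C) * (1 + 2 * C) / 6)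
        + ((m n j 1 - m n j 2) / 2
          + 2 * ((1 - C) * (1 - 2 * C) / 6) * m n j 0) ^ 2 / ((1 - C) * (1 - 2 * C) / 6) := by
    intro j
    -- Summed over the three populations, the extra terms are −4c ∑ fᵢ + 4c² ∑ wᵢ with c = ∑ fᵢ and
    -- ∑ wᵢ = 1, so they cancel.
    have expand : ∀ a b c : ℝ, 0 < b → (-a + 2 * b * c) ^ 2 / b
        = a ^ 2 / b - 4 * a * c + 4 * b * c ^ 2 := fun a b c hb => by
      field_simp; ring
    rw [show m n j 2 - m n j 0 = -(m n j 0 - m n j 2) by ring,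
      show -(m n j 1 + m n j 2) / 2 = -((m n j 1 + m n j 2) / 2) by ring,
      show (m n j 1 - m n j 2) / 2 = -((m n j 2 - m n j 1) / 2) by ring,
      expand _ _ _ p0, expand _ _ _ p1, expand _ _ _ p2, populationEnergy]
    ring
  simp only [hnew, hold] at h ⊢
  exact threePoint_shift_invariance
    (p := fun j => (m n j 2 - m n j 0 + 2 * (2 * (1 - C ^ 2) / 3) * m n j 0) ^ 2
      / (2 * (1 - C ^ 2) / 3))
    (q := fun j => (-(m n j 1 + m n j 2) / 2
      + 2 * ((1 + C) * (1 + 2 * C) / 6) * m n j 0) ^ 2 / ((1 + C) * (1 + 2 * C) / 6))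
    (r := fun j => ((m n j 1 - m n j 2) / 2
      + 2 * ((1 - C) * (1 - 2 * C) / 6) * m n j 0) ^ 2 / ((1 - C) * (1 - 2 * C) / 6))
    (fun j => by positivity) (fun j => by positivity) (fun j => by positivity) h

theorem l2Stable_fourthOrderD1Q3 (s₁ : ℝ) {C : ℝ} (hC : |C| < 1 / 2) :
    (fourthOrderD1Q3 s₁ C).L2Stable := by
  obtain ⟨A, hA, hle⟩ := exists_populationEnergy_le hC
  have hge := sq_add_sq_add_sq_le_populationEnergy hC
  have hpos : ∀ x y z, 0 ≤ populationEnergy C x y z := fun x y z => by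
    linarith [hge x y z, sq_nonneg x, sq_nonneg y, sq_nonneg z]
  refine ⟨5 * A, by positivity, fun Δx hΔx m h0 hm n => ?_⟩
  have h0' : ∀ i, Summable fun j => m 0 j i ^ 2 := fun i =>
    (summable_mul_left_iff hΔx.ne').mp (h0 i)
  have s0 : Summable fun j => m 0 j 0 ^ 2 + m 0 j 1 ^ 2 + m 0 j 2 ^ 2 :=
    ((h0' 0).add (h0' 1)).add (h0' 2)
  have se0 : Summable fun j => populationEnergy C (m 0 j 0) (m 0 j 1) (m 0 j 2) :=
    (s0.mul_left A).of_nonneg_of_le (fun _ => hpos _ _ _) fun _ => hle _ _ _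
  have hn : (Summable fun j => populationEnergy C (m n j 0) (m n j 1) (m n j 2)) ∧
      ∑' j, populationEnergy C (m n j 0) (m n j 1) (m n j 2)
        = ∑' j, populationEnergy C (m 0 j 0) (m 0 j 1) (m 0 j 2) := by
    induction n with
    | zero => exact ⟨se0, rfl⟩
    | succ n ih =>
      obtain ⟨i1, i2⟩ := populationEnergy_conserved hC hm n ih.1
      exact ⟨i1, i2.trans ih.2⟩
  have sn : Summable fun j => m n j 0 ^ 2 + m n j 1 ^ 2 + m n j 2 ^ 2 :=
    (hn.1.mul_left 5).of_nonneg_of_le (fun _ => by positivity) fun _ => hge _ _ _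
  refine ⟨fun i => (sn.of_nonneg_of_le (fun _ => sq_nonneg _) fun j => ?_).mul_left Δx, ?_⟩
  · fin_cases i <;> simp <;> nlinarith [sq_nonneg (m n j 0), sq_nonneg (m n j 1),
      sq_nonneg (m n j 2)]
  · simp only [tsum_mul_left, Fin.sum_univ_three]
    have i1 := sn.tsum_le_tsum (fun _ => hge _ _ _) (hn.1.mul_left 5)
    have i2 := se0.tsum_le_tsum (fun _ => hle _ _ _) (s0.mul_left A)
    rw [tsum_mul_left] at i1 i2
    rw [hn.2] at i1
    nlinarith

/-! ### Instability of the Finite Difference scheme -/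

theorem shiftAction_neg (p : ℝ[T;T⁻¹]) (u : ℤ → ℝ) (j : ℤ) :
    shiftAction (-p) u j = -shiftAction p u j := by
  have h := shiftAction_add (-p) p u j
  rw [neg_add_cancel, show shiftAction 0 u j = 0 by simp [shiftAction]] at h
  linarith

theorem numNonEquil_fourthOrderD1Q3 (s₁ C : ℝ) : (fourthOrderD1Q3 s₁ C).numNonEquil = 2 := by
  have h : ∀ i : Fin 3, (i ≠ 0 ∧ (fourthOrderD1Q3 s₁ C).relax i ≠ 1) ↔ i ≠ 0 := by
    intro i
    fin_cases i <;> simp [fourthOrderD1Q3]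
  simp only [LBScheme.numNonEquil, h]
  rw [Nat.card_eq_fintype_card]
  decide

/-- The companion matrix of the corresponding Finite Difference scheme. -/
def fdCompanion (S : LBScheme 3) : Matrix (Fin 3) (Fin 3) ℝ[T;T⁻¹] :=
  !![-S.charCoeff 2, -S.charCoeff 1, -S.charCoeff 0; 1, 0, 0; 0, 1, 0]

theorem LBScheme.FDStable.exists_shiftBounded {S : LBScheme 3} (hs : S.numNonEquil = 2)
    (h : S.FDStable) : ∃ K, ShiftBounded (fdCompanion S) K := by
  obtain ⟨K, -, hK⟩ := h
  -- Each companion state holds three consecutive time levels, each bounded by K times the data.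
  refine ⟨3 * K, fun m ⟨L, hL⟩ hm n => ?_⟩
  have hone : ∀ (u : ℤ → ℝ) (j : ℤ), shiftAction 1 u j = u j := fun u j => by
    simpa using shiftAction_C 1 u j
  have hzero : ∀ (u : ℤ → ℝ) (j : ℤ), shiftAction 0 u j = 0 := fun u j => by
    simp [shiftAction]
  have e0 : ∀ n j, m (n + 1) j 0 = -(shiftAction (S.charCoeff 2) (fun l => m n l 0) j
      + shiftAction (S.charCoeff 1) (fun l => m n l 1) j
      + shiftAction (S.charCoeff 0) (fun l => m n l 2) j) := fun n j => by
    rw [hm]; simp [fdCompanion, Fin.sum_univ_three, shiftAction_neg]; ring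
  have e1 : ∀ n j, m (n + 1) j 1 = m n j 0 := fun n j => by
    rw [hm]; simp [fdCompanion, Fin.sum_univ_three, hone, hzero]
  have e2 : ∀ n j, m (n + 1) j 2 = m n j 1 := fun n j => by
    rw [hm]; simp [fdCompanion, Fin.sum_univ_three, hone, hzero]
  -- The companion state is (u^{n+2}, u^{n+1}, u^n), so the initial components are read backwards.
  let u : ℕ → ℤ → ℝ := fun n j => match n with
    | 0 => m 0 j 2
    | 1 => m 0 j 1
    | n + 2 => m n j 0
  have u0 : ∀ n j, m n j 0 = u (n + 2) j := fun n j => rfl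
  have u1 : ∀ n j, m n j 1 = u (n + 1) j := fun n j => by
    cases n with
    | zero => rfl
    | succ n => exact e1 n j
  have u2 : ∀ n j, m n j 2 = u n j := fun n j => by
    cases n with
    | zero => rfl
    | succ n => rw [e2, u1]
  have hu : S.IsFDSolution u := by
    intro k hk j
    rw [hs] at hk ⊢
    obtain ⟨n, rfl⟩ := Nat.exists_eq_add_of_le' hk
    rw [show n + 2 + 1 = n + 1 + 2 from rfl, ← u0, e0]
    simp only [u0, u1, u2, Finset.sum_range_succ, Finset.sum_range_zero, zero_add]
    rfl
  have hsupp : ∀ i, Summable fun j => m 0 j i ^ 2 := by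
    intro i
    refine summable_of_hasFiniteSupport ((Set.finite_Icc (-L : ℤ) L).subset fun j hj => ?_)
    by_contra hj'
    refine hj ?_
    have : m 0 j = 0 := hL j (lt_of_not_ge fun h => hj' (Set.mem_Icc.mpr (abs_le.mp h)))
    simp [this]
  have key := hK 1 one_pos u (fun l hl => by
    rw [hs] at hl
    simp only [IsSquareSummable, one_mul]
    interval_cases l
    · exact hsupp 2
    · exact hsupp 1
    · exact hsupp 0) hu
  rw [hs] at key
  simp only [IsSquareSummable, one_mul, Finset.sum_range_succ, Finset.sum_range_zero,
    zero_add] at key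
  have hsum : ∀ n, (Summable fun j => ∑ i, m n j i ^ 2) ∧ ∑' j, ∑ i, m n j i ^ 2
      = ∑' j, u (n + 2) j ^ 2 + ∑' j, u (n + 1) j ^ 2 + ∑' j, u n j ^ 2 := by
    intro n
    simp only [Fin.sum_univ_three, u0, u1, u2]
    have a0 := (key (n + 2)).1
    have a1 := (key (n + 1)).1
    have a2 := (key n).1
    exact ⟨(a0.add a1).add a2, by rw [(a0.add a1).tsum_add a2, a0.tsum_add a1]⟩
  refine ⟨(hsum n).1, ?_⟩
  rw [(hsum n).2, (hsum 0).2]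
  linarith [(key n).2, (key (n + 1)).2, (key (n + 2)).2]

theorem eval₂_charCoeff {q : ℕ} [NeZero q] (S : LBScheme q) (κ : ℂˣ) (l : ℕ) :
    LaurentPolynomial.eval₂ (algebraMap ℝ ℂ) κ (S.charCoeff l) = (S.symbol κ).charpoly.coeff l := by
  rw [LBScheme.charCoeff, ← Polynomial.coeff_map, ← Matrix.charpoly_map]
  rfl

theorem charpoly_symbol_one (s₁ C : ℝ) :
    ((fourthOrderD1Q3 s₁ C).symbol 1).charpoly
      = Polynomial.X ^ 3 + Polynomial.X ^ 2 - Polynomial.X - 1 := by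
  have h : (fourthOrderD1Q3 s₁ C).symbol 1
      = !![1, 0, 0; (2 * C : ℂ), -1, 0; (2 * ((1 + 2 * C ^ 2) / 3) : ℂ), 0, -1] := by
    rw [symbol_fourthOrderD1Q3 s₁ C 1 (k := 1) (l := 1) rfl (by simp) (by simp)]
    ext i j
    fin_cases i <;> fin_cases j <;> simp <;> ring
  rw [h, Matrix.charpoly, Matrix.det_fin_three]
  simp
  ring

theorem not_fdStable_fourthOrderD1Q3 (s₁ C : ℝ) : ¬(fourthOrderD1Q3 s₁ C).FDStable := by
  intro h
  obtain ⟨K, hK⟩ := h.exists_shiftBounded (numNonEquil_fourthOrderD1Q3 s₁ C)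
  have hE : (fdCompanion (fourthOrderD1Q3 s₁ C)).map (LaurentPolynomial.eval₂ (algebraMap ℝ ℂ) 1)
      = !![-1, 1, 1; 1, 0, 0; 0, 1, 0] := by
    refine Matrix.ext fun i j => ?_
    fin_cases i <;> fin_cases j <;>
      simp [fdCompanion, eval₂_charCoeff, charpoly_symbol_one, Polynomial.coeff_X,
        Polynomial.coeff_one]
  -- The companion eigenvector for z is w = (z², z, 1), and v is z times its z-derivative, both at z
  -- = −1.
  refine hK.not_of_jordan (κ := 1) (by simp) (z := -1) (by simp) (v := ![2, -1, 0])
    (w := ![1, -1, 1]) (fun h => by simpa using congrFun h 0) ?_ ?_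
  · rw [hE]
    ext i
    fin_cases i <;> simp [Matrix.mulVec, dotProduct, Fin.sum_univ_three]
  · rw [hE]
    ext i
    fin_cases i <;> simp [Matrix.mulVec, dotProduct, Fin.sum_univ_three] <;> norm_num

/-! ### The von Neumann condition -/

theorem LBScheme.L2Stable.vonNeumannStable {q : ℕ} [NeZero q] {S : LBScheme q}
    (h : S.L2Stable) : S.VonNeumannStable := by
  obtain ⟨K, hK⟩ := h.exists_shiftBounded
  intro θ _ z hz
  rw [mem_closedBall_zero_iff]
  exact hK.norm_eigenvalue_le_one (by simp) hz

theorem vonNeumannStable_of_abs_eq_half (s₁ : ℝ) {C : ℝ} (hC : |C| = 1 / 2) :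
    (fourthOrderD1Q3 s₁ C).VonNeumannStable := by
  intro θ _ z hz
  rw [mem_spectrum_symbol_iff] at hz
  have hκ : ‖((Circle.toUnits (Circle.exp θ) : ℂˣ) : ℂ)‖ = 1 := by simp
  rw [mem_closedBall_zero_iff]
  generalize ((Circle.toUnits (Circle.exp θ) : ℂˣ) : ℂ) = k at hz hκ
  have hk : ‖k⁻¹‖ = 1 := by rw [norm_inv, hκ, inv_one]
  have main : ∀ a b : ℂ, ‖a‖ = 1 → ‖b‖ = 1 → (z + a) * (z ^ 2 - b) = 0 → ‖z‖ ≤ 1 := by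
    intro a b ha hb h
    rcases mul_eq_zero.mp h with h | h
    · rw [eq_neg_of_add_eq_zero_left h, norm_neg, ha]
    · have h2 : ‖z‖ ^ 2 = 1 := by rw [← norm_pow, sub_eq_zero.mp h, hb]
      nlinarith [norm_nonneg z]
  have hk0 : k * k⁻¹ = 1 := mul_inv_cancel₀ (by rintro rfl; simp at hκ)
  -- For C = 1/2 the characteristic polynomial is (z + κ)(z² − κ⁻¹); changing the sign of C
  -- exchanges κ and κ⁻¹.
  rcases eq_or_eq_neg_of_abs_eq hC with rfl | rfl
  · refine main k k⁻¹ hκ hk ?_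
    simp only [symbolTrace, inv_inv] at hz
    push_cast at hz
    linear_combination hz - hk0
  · refine main k⁻¹ k hk hκ ?_
    simp only [symbolTrace, inv_inv] at hz
    push_cast at hz
    linear_combination hz - hk0

theorem discr_nonpos_of_vonNeumannStable {s₁ C : ℝ}
    (h : (fourthOrderD1Q3 s₁ C).VonNeumannStable) {x a B : ℝ} (hx : x ∈ Set.Icc (-1 : ℝ) 1)
    (ha : a = 1 - 2 * x + 2 * (1 + 2 * C ^ 2) / 3 * (x - 1)) (hB : B = 4 * C ^ 2 * (1 - x ^ 2)) :
    (a ^ 2 + B) ^ 2 - 8 * (a ^ 3 - 3 * a * B) + 18 * (a ^ 2 + B) - 27 ≤ 0 := by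
  set θ := Real.arccos x with hθ
  have hcos : Real.cos θ = x := Real.cos_arccos hx.1 hx.2
  have hsin : Real.sin θ ^ 2 = 1 - x ^ 2 := by rw [← hcos, Real.sin_sq]
  have hB' : B = (-2 * C * Real.sin θ) ^ 2 := by rw [hB, mul_pow, hsin]; ring
  rw [hB']
  refine discr_nonpos_of_roots_mem_disk fun z hz => ?_
  have hmem : θ ∈ Set.Icc (-Real.pi) Real.pi :=
    ⟨by linarith [Real.arccos_nonneg x, Real.pi_pos], Real.arccos_le_pi x⟩
  have := h θ hmem
  rw [← mem_closedBall_zero_iff]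
  refine this ((mem_spectrum_symbol_iff _ _ _ _).mpr ?_)
  have hκ : ((Circle.toUnits (Circle.exp θ) : ℂˣ) : ℂ) = ⟨x, Real.sin θ⟩ := by
    rw [Circle.toUnits_apply]
    simp only [Units.val_mk0, Circle.coe_exp]
    apply Complex.ext
    · rw [Complex.exp_ofReal_mul_I_re, hcos]
    · rw [Complex.exp_ofReal_mul_I_im]
  have hκi : ((Circle.toUnits (Circle.exp θ) : ℂˣ) : ℂ)⁻¹ = ⟨x, -Real.sin θ⟩ := by
    rw [hκ]
    refine inv_eq_of_mul_eq_one_right ?_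
    apply Complex.ext
    · simp; nlinarith
    · simp; ring
  have t1 : symbolTrace C ((Circle.toUnits (Circle.exp θ) : ℂˣ) : ℂ)
      = ⟨a, -2 * C * Real.sin θ⟩ := by
    rw [symbolTrace, hκi, hκ, ha]
    simp only [Complex.mk_eq_add_mul_I]
    push_cast
    ring
  have t2 : symbolTrace C ((Circle.toUnits (Circle.exp θ) : ℂˣ) : ℂ)⁻¹
      = ⟨a, -(-2 * C * Real.sin θ)⟩ := by
    rw [symbolTrace, inv_inv, hκi, hκ, ha]
    simp only [Complex.mk_eq_add_mul_I]
    push_cast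
    ring
  rw [t1, t2]
  exact hz

theorem not_vonNeumannStable_of_half_lt_abs (s₁ : ℝ) {C : ℝ} (hC : 1 / 2 < |C|) (h1 : |C| ≠ 1) :
    ¬(fourthOrderD1Q3 s₁ C).VonNeumannStable := by
  intro h
  have hsq : 1 / 4 < C ^ 2 := by rw [← sq_abs]; nlinarith
  rcases lt_or_gt_of_ne h1 with h1 | h1
  · have hsq1 : C ^ 2 < 1 := by rw [← sq_abs]; nlinarith
    -- This cosine is affine in C² and meets zeros of the discriminant at both ends: −1/2 at |C| =
    -- 1/2 and 0 at |C| = 1. In between, with x = −t, the discriminant factors with positive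
    -- factors.
    have := discr_nonpos_of_vonNeumannStable h (x := (2 * C ^ 2 - 2) / 3)
      ⟨by linarith, by linarith⟩ rfl rfl
    obtain ⟨t, ht⟩ : ∃ t, t = 2 / 3 * (1 - C ^ 2) := ⟨_, rfl⟩
    have hC2 : C ^ 2 = 1 - 3 / 2 * t := by rw [ht]; ring
    have t0 : 0 < t := by linarith
    have t1 : 0 < 1 - 2 * t := by linarith
    have t2 : 0 < 1 - t := by linarith
    rw [hC2] at this
    have hpos : 0 < 8 * (1 + t) * (1 - t) * t * (1 - 2 * t)
        * (1 + 13 / 2 * t + 11 * t ^ 2 + 15 / 2 * t ^ 3 + t ^ 4) := by positivity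
    refine absurd this (not_le.mpr (lt_of_lt_of_eq hpos ?_))
    ring
  · have hsq1 : 1 < C ^ 2 := by rw [← sq_abs]; nlinarith
    -- At κ = −1 the trace is real, B = 0, and the discriminant is (a − 3)³(a + 1), with both a − 3
    -- and a + 1 negative.
    have := discr_nonpos_of_vonNeumannStable h (x := -1) ⟨le_rfl, by norm_num⟩ rfl rfl
    have hpos : 0 < (8 * (C ^ 2 - 1) / 3) * (4 + 8 * (C ^ 2 - 1) / 3) ^ 3 := by
      have : 0 < C ^ 2 - 1 := by linarith
      positivity
    refine absurd this (not_le.mpr (lt_of_lt_of_eq hpos ?_))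
    ring

/-! ### Jordan blocks at |C| = 1 and |C| = 1/2 -/

theorem not_l2Stable_of_abs_eq_one (s₁ : ℝ) {C : ℝ} (hC : |C| = 1) :
    ¬(fourthOrderD1Q3 s₁ C).L2Stable := by
  intro h
  obtain ⟨K, hK⟩ := h.exists_shiftBounded
  have hC2 : (C : ℂ) ^ 2 = 1 := by
    rw [← Complex.ofReal_pow, ← sq_abs, hC]; norm_num
  -- At κ = −1 the eigenvalues are 1, −1, −1; below, v = e₁ and w = −(Ê + 1)v.
  have hE := symbol_fourthOrderD1Q3 s₁ C (-1) (e := 1) (k := -1) (l := -1)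
    (by rw [hC2]; norm_num) (by simp) (by norm_num)
  rw [LBScheme.symbol] at hE
  refine hK.not_of_jordan (κ := -1) (by simp) (z := -1) (by simp) (v := ![1, 0, 0])
    (w := ![2, 2 * C, 2]) (fun h => by simpa using congrFun h 0) ?_ ?_
  · rw [hE]
    ext i
    fin_cases i <;> simp [Matrix.mulVec, dotProduct, Fin.sum_univ_three] <;> ring
  · rw [hE]
    ext i
    fin_cases i <;> simp [Matrix.mulVec, dotProduct, Fin.sum_univ_three] <;> ring

theorem exists_primitive_cube_root :
    ∃ ω : ℂ, ω ^ 2 = -1 - ω ∧ ‖ω‖ = 1 ∧ ‖-1 - ω‖ = 1 := by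
  have h : IsPrimitiveRoot (Complex.exp (2 * Real.pi * Complex.I / (3 : ℕ))) 3 :=
    Complex.isPrimitiveRoot_exp 3 (by norm_num)
  obtain ⟨ω, hω⟩ : ∃ ω, ω = Complex.exp (2 * Real.pi * Complex.I / (3 : ℕ)) := ⟨_, rfl⟩
  rw [← hω] at h
  have hs := h.geom_sum_eq_zero (by norm_num)
  simp only [Finset.sum_range_succ, Finset.sum_range_zero] at hs
  have h2 : ω ^ 2 = -1 - ω := by linear_combination hs
  have hn : ‖ω‖ = 1 := Complex.norm_eq_one_of_pow_eq_one h.pow_eq_one (by norm_num)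
  exact ⟨ω, h2, hn, by rw [← h2, norm_pow, hn, one_pow]⟩

theorem not_l2Stable_of_abs_eq_half (s₁ : ℝ) {C : ℝ} (hC : |C| = 1 / 2) :
    ¬(fourthOrderD1Q3 s₁ C).L2Stable := by
  intro h
  obtain ⟨K, hK⟩ := h.exists_shiftBounded
  obtain ⟨ω, h2, hn, hn'⟩ := exists_primitive_cube_root
  have hmul : ω * (-1 - ω) = 1 := by linear_combination -h2
  have hmul' : (-1 - ω) * ω = 1 := by linear_combination -h2
  have hinv : ω⁻¹ = -1 - ω := inv_eq_of_mul_eq_one_right hmul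
  have hinv' : (-1 - ω)⁻¹ = ω := inv_eq_of_mul_eq_one_right hmul'
  -- From (z + κ)(z² − κ⁻¹) at C = 1/2, −κ is a double root when κ³ = 1. At κ = 1 the symbol is
  -- diagonalizable, so κ = ω is taken. For C = −1/2, κ = ω⁻¹ = −1 − ω gives the same eigenvalue −ω.
  rcases eq_or_eq_neg_of_abs_eq hC with rfl | rfl
  · have hE := symbol_fourthOrderD1Q3 s₁ (1 / 2) ⟨ω, -1 - ω, hmul, hmul'⟩ (e := 1 / 2) (k := ω)
      (l := -1 - ω) (by norm_num) rfl hinv.symm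
    rw [LBScheme.symbol] at hE
    refine hK.not_of_jordan (κ := ⟨ω, -1 - ω, hmul, hmul'⟩) hn (z := -ω) (by simpa using hn)
      (v := ![1 - ω, -3 - ω, 1 - ω]) (w := ![3, 1 - ω, 1 - ω])
      (fun h => by simpa using congrFun h 0) ?_ ?_ <;>
    · rw [hE]
      ext i
      fin_cases i <;> simp [Matrix.mulVec, dotProduct, Fin.sum_univ_three] <;> ring_nf <;>
        simp only [h2] <;> ring
  · have hE := symbol_fourthOrderD1Q3 s₁ (-(1 / 2)) ⟨-1 - ω, ω, hmul', hmul⟩ (e := 1 / 2)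
      (k := -1 - ω) (l := ω) (by norm_num) rfl hinv'.symm
    rw [LBScheme.symbol] at hE
    refine hK.not_of_jordan (κ := ⟨-1 - ω, ω, hmul', hmul⟩) hn' (z := -ω) (by simpa using hn)
      (v := ![1 - ω, 3 + ω, 1 - ω]) (w := ![3, ω - 1, 1 - ω])
      (fun h => by simpa using congrFun h 0) ?_ ?_ <;>
    · rw [hE]
      ext i
      fin_cases i <;> simp [Matrix.mulVec, dotProduct, Fin.sum_univ_three] <;> ring_nf <;>
        simp only [h2] <;> ring

end

theorem mainTheorem7 (s₁ C : ℝ) :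
    (|C| ≠ 1 → ((fourthOrderD1Q3 s₁ C).VonNeumannStable ↔ |C| ≤ 1 / 2)) ∧
    ((fourthOrderD1Q3 s₁ C).L2Stable ↔ |C| < 1 / 2) ∧
    ¬ (fourthOrderD1Q3 s₁ C).FDStable := by
  refine ⟨fun h1 => ⟨fun h => ?_, fun h => ?_⟩, ⟨fun h => ?_, l2Stable_fourthOrderD1Q3 s₁⟩,
    not_fdStable_fourthOrderD1Q3 s₁ C⟩
  · by_contra! hC
    exact not_vonNeumannStable_of_half_lt_abs s₁ hC h1 h
  · rcases h.lt_or_eq with h | h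
    · exact (l2Stable_fourthOrderD1Q3 s₁ h).vonNeumannStable
    · exact vonNeumannStable_of_abs_eq_half s₁ h
  · by_contra! hC
    rcases hC.eq_or_lt with hC | hC
    · exact not_l2Stable_of_abs_eq_half s₁ hC.symm h
    · by_cases h1 : |C| = 1
      · exact not_l2Stable_of_abs_eq_one s₁ h1 h
      · exact not_vonNeumannStable_of_half_lt_abs s₁ hC h1 h.vonNeumannStable
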